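/- For a finite simple graph $G$, let $\mathcal N[G]$ be its neighborhood complex, i.e. the abstract simplicial complex whose faces are the nonempty sets of vertices of $G$ having a common neighbor, and let $\|\mathcal N[G]\|$ be its geometric realization. A space $X$ is called $k$-connected if it is nonempty (when $k\ge -1$) and, for every $m=0,1,\dots,k$, every continuous map $S^m\to X$ extends to a continuous map $B^{m+1}\to X$; for $k\le -2$ every space is $k$-connected. Let $G(n,p)$ be the random graph on $n$ labelled vertices in which each edge is present independently with probability $p$. Let $p=p(n)\in[0,1]$ and let $i=i(n)$ be integers with $i(n)\ge 0$ for all $n$ and $i(n)\le n$ for all sufficiently large $n$. If $$\binom{n}{i}\,(1-p^i)^{n-i}=o(1)\qquad (n\to\infty),$$ then $\|\mathcal N[G(n,p)]\|$ is almost always $(i-2)$-connected, i.e. the probability that $\|\mathcal N[G(n,p)]\|$ is $(i-2)$-connected tends to $1$ as $n\to\infty$. -/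

import Mathlib

open Filter Topology Asymptotics

/-- The neighborhood complex of a simple graph `G`: its faces are the nonempty finite sets of
vertices that have a common neighbor. -/
def neighborhoodComplex {V : Type*} (G : SimpleGraph V) : PreAbstractSimplicialComplex V where
  faces := {s | s.Nonempty ∧ ∃ v : V, ∀ u ∈ s, G.Adj v u}
  isRelLowerSet_faces := by
    rintro s ⟨hs, v, hv⟩
    exact ⟨hs, fun t hts ht => ⟨ht, v, fun u hu => hv u (hts hu)⟩⟩

/-- The geometric realization of a finite abstract simplicial complex in barycentric coordinates:
the points `x` of the standard simplex on the vertex set that are supported on a face. It carries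
the subspace topology from `V → ℝ`. -/
def geometricRealization {V : Type*} [Fintype V] (K : PreAbstractSimplicialComplex V) :
    Set (V → ℝ) :=
  {x | x ∈ stdSimplex ℝ V ∧ ∃ s ∈ K.faces, ∀ v, x v ≠ 0 → v ∈ s}

/-- A topological space is `k`-connected if, for each dimension `-1 ≤ m ≤ k`, every continuous map
from the unit sphere `S^m` extends to the closed unit ball `B^(m+1)`. For `m = -1` (where the sphere
is empty and the ball is a point) this says that the space is nonempty; for `k ≤ -2` there is no
condition. -/
def IsKConnected (k : ℤ) (X : Type*) [TopologicalSpace X] : Prop :=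
  (-1 ≤ k → Nonempty X) ∧
    ∀ m : ℕ, (m : ℤ) ≤ k →
      ∀ f : C(Metric.sphere (0 : EuclideanSpace ℝ (Fin (m + 1))) 1, X),
        ∃ g : C(Metric.closedBall (0 : EuclideanSpace ℝ (Fin (m + 1))) 1, X),
          ∀ x : Metric.sphere (0 : EuclideanSpace ℝ (Fin (m + 1))) 1,
            g ⟨x, Metric.sphere_subset_closedBall x.2⟩ = f x

/-- The random graph `G(n, p(n))` on `n` vertices almost always has the property `P`: its
probability of having it tends to `1` as `n → ∞`. -/
def AlmostAlways (p : ℕ → unitInterval) (P : (n : ℕ) → SimpleGraph (Fin n) → Prop) : Prop :=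
  Tendsto (fun n : ℕ => SimpleGraph.binomialRandom (Fin n) (p n) {G | P n G}) atTop (𝓝 1)

/-!
The proof has a probabilistic and a topological half.

A fixed `i`-set `s` has no common neighbor with probability at most `(1 - p ^ i) ^ (n - i)`, because
the `n - i` vertices outside `s` are joined to all of `s` independently of one another, each with
probability `p ^ i` (`binomialRandom_no_common_neighbor_le`). By the union bound, the hypothesis says
that with probability tending to `1` every `i`-set of vertices has a common neighbor. Then the
neighborhood complex contains the full `(i-1)`-skeleton of the simplex on the vertices.

It remains to see that a complex `K` containing the full `(i-1)`-skeleton is `(i-2)`-connected. Given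
`f : S^m → ‖K‖` with `m ≤ i - 2`, it is enough to find a map `g` into the `m`-skeleton with the
support of `g x` contained in that of `f x` for each `x` (`exists_carried_card_support_le`): then `f`
is homotopic to `g` along straight segments inside `‖K‖`, and the cone over `g` from any vertex lies
in the `(m+1)`-skeleton, hence in `‖K‖`. This is a form of simplicial approximation, but no
subdivision of the sphere is needed: `f` is approximated by a differentiable map in general position,
in the sense that no `m + 2` barycentric coordinates coincide anywhere on the `m`-dimensional sphere
(`exists_perturbation`), after which the `(m+2)`-nd largest coordinate is subtracted from all
coordinates and negative values are replaced by zero.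
-/

open MeasureTheory ProbabilityTheory

/-! ### Compressing maps from spheres into skeleta -/

/-- Stone-Weierstrass for the algebra of restrictions to `K` of differentiable functions on `E`,
which separates points because it contains the continuous linear functionals. -/
theorem exists_differentiable_approx {E : Type*} [NormedAddCommGroup E] [NormedSpace ℝ E]
    {K : Set E} (hK : IsCompact K) (f : C(K, ℝ)) {ε : ℝ} (hε : 0 < ε) :
    ∃ F : E → ℝ, Differentiable ℝ F ∧ ∀ x : K, |F x - f x| < ε := by
  have := isCompact_iff_compactSpace.mp hK
  let A : Subalgebra ℝ C(K, ℝ) :=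
    { carrier := {g | ∃ F : E → ℝ, Differentiable ℝ F ∧ ∀ x : K, g x = F x}
      mul_mem' := by
        rintro a b ⟨F, hF, ha⟩ ⟨F', hF', hb⟩
        exact ⟨fun x => F x * F' x, hF.mul hF', fun x => by simp [ha, hb]⟩
      add_mem' := by
        rintro a b ⟨F, hF, ha⟩ ⟨F', hF', hb⟩
        exact ⟨fun x => F x + F' x, hF.add hF', fun x => by simp [ha, hb]⟩
      algebraMap_mem' := fun r => ⟨fun _ => r, differentiable_const r, fun x => by simp⟩ }
  have hA : A.SeparatesPoints := by
    intro x y hxy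
    obtain ⟨φ, hφ⟩ := SeparatingDual.exists_separating_of_ne (R := ℝ) (Subtype.coe_ne_coe.mpr hxy)
    exact ⟨_, ⟨⟨fun z => φ z, by fun_prop⟩, ⟨φ, φ.differentiable, fun _ => rfl⟩, rfl⟩, hφ⟩
  obtain ⟨⟨g, F, hF, hgF⟩, hg⟩ :=
    ContinuousMap.exists_mem_subalgebra_near_continuousMap_of_separatesPoints A hA f ε hε
  refine ⟨F, hF, fun x => ?_⟩
  rw [← hgF, ← Real.norm_eq_abs]
  exact (ContinuousMap.norm_coe_le_norm (g - f) x).trans_lt hg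

/-- General position. For `m + 2` given indices, requiring all the functions `h v + c v` with these
indices to agree at `x` is `m + 1` equations on `x`, and the sphere `S^m` has Lebesgue measure zero
in `ℝ^(m+1)`, hence so has its image under a differentiable map to `ℝ^(m+1)`. So for almost every
vector `c` of constants no such coincidence occurs on the sphere. -/
theorem exists_perturbation {V : Type*} [Fintype V] {m : ℕ}
    {h : V → EuclideanSpace ℝ (Fin (m + 1)) → ℝ} (hh : ∀ v, Differentiable ℝ (h v))
    {U : Set (V → ℝ)} (hU : IsOpen U) (hne : U.Nonempty) :
    ∃ c ∈ U, ∀ e : Fin (m + 2) ↪ V,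
      ∀ x ∈ Metric.sphere (0 : EuclideanSpace ℝ (Fin (m + 1))) 1,
        ∃ j, h (e j) x + c (e j) ≠ h (e 0) x + c (e 0) := by
  set S := Metric.sphere (0 : EuclideanSpace ℝ (Fin (m + 1))) 1
  have key : ∀ e : Fin (m + 2) ↪ V, ∀ᵐ c : V → ℝ, ∀ x ∈ S,
      ∃ j, h (e j) x + c (e j) ≠ h (e 0) x + c (e 0) := by
    intro e
    let Φ : EuclideanSpace ℝ (Fin (m + 1)) → EuclideanSpace ℝ (Fin (m + 1)) :=
      fun x => WithLp.toLp 2 fun j => h (e 0) x - h (e j.succ) x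
    have hΦ : Differentiable ℝ Φ := by
      rw [differentiable_euclidean]
      exact fun j => (hh _).sub (hh _)
    let L : (V → ℝ) →ₗ[ℝ] EuclideanSpace ℝ (Fin (m + 1)) :=
      { toFun := fun c => WithLp.toLp 2 fun j => c (e j.succ) - c (e 0)
        map_add' := fun a b => by ext j; simp; ring
        map_smul' := fun r a => by ext j; simp; ring }
    have hL : Function.Surjective L := by
      intro y
      refine ⟨Function.extend e (Fin.cons 0 y) 0, ?_⟩
      ext j
      simp [L, e.injective.extend_apply]
    have hnull : volume (Φ '' S) = 0 :=
      addHaar_image_eq_zero_of_differentiableOn_of_addHaar_eq_zero volume hΦ.differentiableOn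
        (Measure.addHaar_sphere volume 0 1)
    have hmeas : MeasurableSet (Φ '' S)ᶜ :=
      (((isCompact_sphere _ _).image hΦ.continuous).isClosed.measurableSet).compl
    have := (ae_comp_linearMap_mem_iff L volume volume hL hmeas).2
      (measure_eq_zero_iff_ae_notMem.1 hnull)
    filter_upwards [this] with c hc x hx
    by_contra! hcon
    refine hc ⟨x, hx, ?_⟩
    ext j
    have := hcon j.succ
    simp only [Φ, L, LinearMap.coe_mk, AddHom.coe_mk]
    linarith
  have hall := ae_all_iff.2 key
  obtain ⟨c, hcU, hc⟩ := (Measure.dense_of_ae hall).inter_open_nonempty U hU hne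
  exact ⟨c, hcU, hc⟩

/-- A map from `S^m` to a simplex can be replaced by a map `g` into the `m`-skeleton that is carried
by the original one: the support of `g x` lies in that of `f x`, so the straight-line homotopy
between them stays in every complex that contains the image of `f`.

The map `g` is obtained by approximating `f` by functions `w` in general position, subtracting from
each coordinate the `(m+2)`-nd largest one (or `0`, if that is larger), truncating at `0` and
normalizing. At most `m + 1` coordinates exceed the `(m+2)`-nd largest one, and they do not all
vanish, since otherwise the `m + 2` largest coordinates would coincide. -/
theorem exists_carried_card_support_le {V : Type*} [Fintype V] {m : ℕ}
    (hV : m + 2 ≤ Fintype.card V)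
    (f : C(Metric.sphere (0 : EuclideanSpace ℝ (Fin (m + 1))) 1, V → ℝ))
    (hf : ∀ x, f x ∈ stdSimplex ℝ V) :
    ∃ g : C(Metric.sphere (0 : EuclideanSpace ℝ (Fin (m + 1))) 1, V → ℝ), ∀ x,
      g x ∈ stdSimplex ℝ V ∧ (∀ v, g x v ≠ 0 → f x v ≠ 0) ∧
        (Finset.univ.filter fun v => g x v ≠ 0).card ≤ m + 1 := by
  classical
  set ε : ℝ := 1 / (3 * Fintype.card V) with hε_def
  have hN : (0 : ℝ) < Fintype.card V := by
    have : 0 < Fintype.card V := by omega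
    exact_mod_cast this
  have hε : 0 < ε := by positivity
  have hεN : Fintype.card V * (3 * ε) = 1 := by rw [hε_def]; field_simp
  have happrox : ∀ v, ∃ F : EuclideanSpace ℝ (Fin (m + 1)) → ℝ, Differentiable ℝ F ∧
      ∀ x : Metric.sphere (0 : EuclideanSpace ℝ (Fin (m + 1))) 1, |F x - f x v| < ε := fun v =>
    exists_differentiable_approx (isCompact_sphere _ _) ⟨fun x => f x v, by fun_prop⟩ hε
  choose h hh hhf using happrox
  -- The constants lie in `(-2ε, -ε)`, so that `f - 3ε < w < f`. By the upper bound, `w` is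
  -- positive only where `f` is; by the lower one, some coordinate of `w x` is positive, as some
  -- coordinate of `f x` is at least `1 / card V = 3ε`.
  obtain ⟨c, hcU, hc⟩ := exists_perturbation hh (U := Set.univ.pi fun _ => Set.Ioo (-(2 * ε)) (-ε))
    (isOpen_set_pi Set.finite_univ fun _ _ => isOpen_Ioo)
    (Set.univ_pi_nonempty_iff.2 fun _ => Set.nonempty_Ioo.2 (by linarith))
  let w : Metric.sphere (0 : EuclideanSpace ℝ (Fin (m + 1))) 1 → V → ℝ := fun x v => h v x + c v
  have hw_lt : ∀ x v, w x v < f x v := fun x v => by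
    have h1 := abs_lt.1 (hhf v x)
    have h2 := hcU v (Set.mem_univ v)
    simp only [w]
    linarith [h1.2, h2.2]
  have hw_gt : ∀ x v, f x v - 3 * ε < w x v := fun x v => by
    have h1 := abs_lt.1 (hhf v x)
    have h2 := hcU v (Set.mem_univ v)
    simp only [w]
    linarith [h1.1, h2.1]
  have hwc : ∀ v, Continuous fun x => w x v := fun v =>
    ((hh v).continuous.comp continuous_subtype_val).add continuous_const
  have hemb : Nonempty (Fin (m + 2) ↪ V) :=
    Function.Embedding.nonempty_of_card_le (by simpa using hV)
  -- `lam x` is the `(m+2)`-nd largest coordinate of `w x`, written as a maximum over `(m+2)`-tuples of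
  -- minima, which makes its continuity evident.
  let lam : Metric.sphere (0 : EuclideanSpace ℝ (Fin (m + 1))) 1 → ℝ := fun x =>
    Finset.univ.sup' Finset.univ_nonempty fun e : Fin (m + 2) ↪ V =>
      Finset.univ.inf' Finset.univ_nonempty fun j => w x (e j)
  have hlam : Continuous lam :=
    Continuous.finset_sup'_apply _ fun e _ => Continuous.finset_inf'_apply _ fun j _ => hwc (e j)
  let k : Metric.sphere (0 : EuclideanSpace ℝ (Fin (m + 1))) 1 → V → ℝ := fun x v =>
    max (w x v - max (lam x) 0) 0
  have hk0 : ∀ x v, 0 ≤ k x v := fun x v => le_max_right _ _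
  have hk_ne : ∀ x v, k x v ≠ 0 → lam x < w x v ∧ 0 < w x v := fun x v hv => by
    have : 0 < w x v - max (lam x) 0 := by
      by_contra hle
      exact hv (max_eq_right (not_lt.1 hle))
    exact ⟨by linarith [le_max_left (lam x) 0], by linarith [le_max_right (lam x) 0]⟩
  have hkc : ∀ v, Continuous fun x => k x v := fun v =>
    ((hwc v).sub (hlam.max continuous_const)).max continuous_const
  have hsum : ∀ x, 0 < ∑ v, k x v := by
    intro x
    have : Nonempty V := Fintype.card_pos_iff.1 (by omega)
    obtain ⟨v₀, hv₀⟩ := Finite.exists_max (w x)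
    have hpos : 0 < w x v₀ := by
      by_contra hle
      have h1 : ∑ v, f x v < ∑ _v : V, 3 * ε :=
        Finset.sum_lt_sum_of_nonempty Finset.univ_nonempty fun v _ => by
          linarith [hw_gt x v, hv₀ v]
      rw [(hf x).2, Finset.sum_const, Finset.card_univ, nsmul_eq_mul, hεN] at h1
      exact lt_irrefl _ h1
    -- Otherwise some `m + 2` coordinates of `w x` all equal the largest one.
    have hgt : lam x < w x v₀ := by
      by_contra hle
      obtain ⟨e, -, he⟩ := Finset.exists_mem_eq_sup' (Finset.univ_nonempty)
        fun e : Fin (m + 2) ↪ V => Finset.univ.inf' Finset.univ_nonempty fun j => w x (e j)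
      have heq : ∀ j, w x (e j) = w x v₀ := fun j =>
        le_antisymm (hv₀ _) ((not_lt.1 hle).trans
          (he.le.trans (Finset.inf'_le (fun j => w x (e j)) (Finset.mem_univ j))))
      obtain ⟨j, hj⟩ := hc e x x.2
      exact hj ((heq j).trans (heq 0).symm)
    refine Finset.sum_pos' (fun v _ => hk0 x v) ⟨v₀, Finset.mem_univ _, ?_⟩
    exact lt_max_of_lt_left (sub_pos.2 (max_lt hgt hpos))
  refine ⟨⟨fun x v => k x v / ∑ u, k x u, continuous_pi fun v =>
    (hkc v).div (continuous_finsetSum _ fun u _ => hkc u) fun x => (hsum x).ne'⟩, fun x => ?_⟩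
  have hne : ∀ v, k x v / ∑ u, k x u ≠ 0 → k x v ≠ 0 := fun v hv h0 => hv (by rw [h0, zero_div])
  refine ⟨⟨fun v => div_nonneg (hk0 x v) (hsum x).le, ?_⟩, fun v hv => ?_, ?_⟩
  · simp only [ContinuousMap.coe_mk]
    rw [← Finset.sum_div, div_self (hsum x).ne']
  · exact ((hk_ne x v (hne v hv)).2.trans (hw_lt x v)).ne'
  · by_contra! hcard
    obtain ⟨e⟩ : Nonempty (Fin (m + 2) ↪ Finset.univ.filter fun v => k x v / ∑ u, k x u ≠ 0) :=
      Function.Embedding.nonempty_of_card_le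
        (by rw [Fintype.card_coe, Fintype.card_fin]; exact hcard)
    let e' : Fin (m + 2) ↪ V := e.trans (Function.Embedding.subtype _)
    have h1 : lam x < Finset.univ.inf' Finset.univ_nonempty fun j => w x (e' j) := by
      rw [Finset.lt_inf'_iff]
      intro j _
      exact (hk_ne x _ (hne _ (Finset.mem_filter.1 (e j).2).2)).1
    exact h1.not_ge (Finset.le_sup' (fun e : Fin (m + 2) ↪ V =>
      Finset.univ.inf' Finset.univ_nonempty fun j => w x (e j)) (Finset.mem_univ e'))

/-! ### Complexes with a full skeleton are highly connected -/

/-- A function `φ` on the unit sphere, spread radially with a profile `a` that vanishes at `0`, is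
continuous on the whole space; at the origin this holds because `φ` is bounded. -/
theorem exists_continuous_radial {E : Type*} [NormedAddCommGroup E] [NormedSpace ℝ E]
    [ProperSpace E] {a : ℝ → ℝ}
    (ha : Continuous a) (h0 : a 0 = 0) (φ : C(Metric.sphere (0 : E) 1, ℝ)) :
    ∃ Φ : E → ℝ, Continuous Φ ∧
      ∀ (r : ℝ) (x : Metric.sphere (0 : E) 1), 0 ≤ r → Φ (r • (x : E)) = a r * φ x := by
  classical
  let ψ : E → ℝ := fun y => if hy : y ∈ Metric.sphere (0 : E) 1 then φ ⟨y, hy⟩ else 0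
  have hψ : ContinuousOn ψ (Metric.sphere (0 : E) 1) := by
    rw [continuousOn_iff_continuous_domRestrict]
    have : (Metric.sphere (0 : E) 1).domRestrict ψ = φ := funext fun y => dif_pos y.2
    exact this ▸ φ.continuous
  have hψ' : ∀ x : Metric.sphere (0 : E) 1, ψ x = φ x := fun x => dif_pos x.2
  obtain ⟨C, hC⟩ := (isCompact_sphere (0 : E) 1).exists_bound_of_continuousOn hψ
  have hC' : ∀ y, ‖ψ y‖ ≤ max C 0 := fun y => by
    by_cases hy : y ∈ Metric.sphere (0 : E) 1
    · exact (hC y hy).trans (le_max_left _ _)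
    · rw [show ψ y = 0 from dif_neg hy, norm_zero]
      exact le_max_right _ _
  have hmem : ∀ y : E, y ≠ 0 → ‖y‖⁻¹ • y ∈ Metric.sphere (0 : E) 1 := fun y hy => by
    simp [norm_smul, hy]
  refine ⟨fun y => a ‖y‖ * ψ (‖y‖⁻¹ • y), ?_, fun r x hr => ?_⟩
  · rw [continuous_iff_continuousAt]
    intro y
    by_cases hy : y = 0
    · subst hy
      have h1 : Tendsto (fun y : E => a ‖y‖) (𝓝 0) (𝓝 0) := by
        have := (ha.comp (continuous_norm (E := E))).tendsto 0
        rwa [Function.comp_apply, norm_zero, h0] at this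
      simp only [ContinuousAt, norm_zero, h0, zero_mul]
      exact h1.zero_mul_isBoundedUnder_le ⟨max C 0,
        eventually_map.2 (Eventually.of_forall fun y => hC' _)⟩
    · have hopen : IsOpen {z : E | z ≠ 0} := isOpen_ne
      have hon : ContinuousOn (fun y : E => a ‖y‖ * ψ (‖y‖⁻¹ • y)) {z : E | z ≠ 0} := by
        refine (ha.comp continuous_norm).continuousOn.mul (hψ.comp ?_ fun z hz => hmem z hz)
        exact (continuous_norm.continuousOn.inv₀ fun z hz => norm_ne_zero_iff.2 hz).smul continuousOn_id
      exact hon.continuousAt (hopen.mem_nhds hy)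
  · have hx : ‖(x : E)‖ = 1 := by simp
    rcases hr.eq_or_lt with rfl | hr
    · simp [h0]
    · simp only [norm_smul, hx, mul_one, Real.norm_eq_abs, abs_of_pos hr]
      rw [smul_smul, inv_mul_cancel₀ hr.ne', one_smul, hψ']

theorem nonempty_geometricRealization {V : Type*} [Fintype V] {K : PreAbstractSimplicialComplex V}
    {v : V} (hv : {v} ∈ K.faces) : Nonempty (geometricRealization K) := by
  classical
  refine ⟨⟨Pi.single v 1, single_mem_stdSimplex ℝ v, {v}, hv, fun u hu => ?_⟩⟩
  rw [Finset.mem_singleton]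
  by_contra hne
  exact hu (Pi.single_eq_of_ne hne 1)

/-- With `g` the compression of `f` to the `m`-skeleton, the extension to the ball follows the
straight-line homotopy from `f` to `g` on the shell `1/2 ≤ ‖y‖ ≤ 1`, and is the cone over `g` with
apex a vertex `v₀` on `‖y‖ ≤ 1/2`. The cone lies in `K` since its points have at most `m + 2`
vertices in their support. -/
theorem exists_extension_of_skeleton {V : Type*} [Fintype V] {K : PreAbstractSimplicialComplex V}
    {m : ℕ} (hV : m + 2 ≤ Fintype.card V)
    (hK : ∀ s : Finset V, s.Nonempty → s.card ≤ m + 2 → s ∈ K.faces)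
    (f : C(Metric.sphere (0 : EuclideanSpace ℝ (Fin (m + 1))) 1, geometricRealization K)) :
    ∃ g : C(Metric.closedBall (0 : EuclideanSpace ℝ (Fin (m + 1))) 1, geometricRealization K),
      ∀ x : Metric.sphere (0 : EuclideanSpace ℝ (Fin (m + 1))) 1,
        g ⟨x, Metric.sphere_subset_closedBall x.2⟩ = f x := by
  classical
  obtain ⟨v₀⟩ : Nonempty V := Fintype.card_pos_iff.1 (by omega)
  let F : C(Metric.sphere (0 : EuclideanSpace ℝ (Fin (m + 1))) 1, V → ℝ) :=
    ⟨fun x => f x, continuous_subtype_val.comp f.continuous⟩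
  obtain ⟨g, hg⟩ := exists_carried_card_support_le hV F fun x => (f x).2.1
  -- The weights of `f`, of `g` and of the apex at distance `r` from the origin.
  let a : ℝ → ℝ := fun r => max (2 * r - 1) 0
  let c : ℝ → ℝ := fun r => max (1 - 2 * r) 0
  let b : ℝ → ℝ := fun r => 1 - a r - c r
  have ha : Continuous a := by fun_prop
  have hc : Continuous c := by fun_prop
  have hb : Continuous b := by fun_prop
  have ha0 : a 0 = 0 := by norm_num [a]
  have hc0 : c 0 = 1 := by norm_num [c]
  have hb0 : b 0 = 0 := by simp [b, ha0, hc0]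
  choose A hA hAx using fun v : V => exists_continuous_radial ha ha0
    (⟨fun x => F x v, by fun_prop⟩ : C(Metric.sphere (0 : EuclideanSpace ℝ (Fin (m + 1))) 1, ℝ))
  choose B hB hBx using fun v : V => exists_continuous_radial hb hb0
    (⟨fun x => g x v, by fun_prop⟩ : C(Metric.sphere (0 : EuclideanSpace ℝ (Fin (m + 1))) 1, ℝ))
  let H : EuclideanSpace ℝ (Fin (m + 1)) → V → ℝ := fun y v =>
    A v y + B v y + c ‖y‖ * Pi.single (M := fun _ => ℝ) v₀ 1 v
  have hH : Continuous H := continuous_pi fun v =>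
    ((hA v).add (hB v)).add ((hc.comp continuous_norm).mul continuous_const)
  have hHx : ∀ (r : ℝ) (x : Metric.sphere (0 : EuclideanSpace ℝ (Fin (m + 1))) 1), 0 ≤ r →
      H (r • (x : EuclideanSpace ℝ (Fin (m + 1)))) =
        a r • F x + b r • g x + c r • Pi.single (M := fun _ => ℝ) v₀ 1 := by
    intro r x hr
    have hx : ‖(x : EuclideanSpace ℝ (Fin (m + 1)))‖ = 1 := by simp
    ext v
    simp [H, hAx v r x hr, hBx v r x hr, norm_smul, hx, abs_of_nonneg hr]
  have hmem : ∀ y ∈ Metric.closedBall (0 : EuclideanSpace ℝ (Fin (m + 1))) 1,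
      H y ∈ geometricRealization K := by
    intro y hy
    obtain ⟨r, x, hr0, hr1, rfl⟩ : ∃ (r : ℝ)
        (x : Metric.sphere (0 : EuclideanSpace ℝ (Fin (m + 1))) 1), 0 ≤ r ∧ r ≤ 1 ∧
        r • (x : EuclideanSpace ℝ (Fin (m + 1))) = y := by
      by_cases h0 : y = 0
      · obtain ⟨x, hx⟩ := (NormedSpace.sphere_nonempty
          (x := (0 : EuclideanSpace ℝ (Fin (m + 1)))) (r := 1)).2 zero_le_one
        exact ⟨0, ⟨x, hx⟩, le_rfl, zero_le_one, by simp [h0]⟩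
      · have hn : ‖y‖ ≠ 0 := norm_ne_zero_iff.2 h0
        exact ⟨‖y‖, ⟨‖y‖⁻¹ • y, by simp [norm_smul, hn]⟩, norm_nonneg y, mem_closedBall_zero_iff.1 hy,
          by simp [smul_smul, hn]⟩
    rw [hHx r x hr0]
    have hsimp := convex_stdSimplex ℝ V
    have hFx : F x ∈ stdSimplex ℝ V := (f x).2.1
    obtain ⟨hgx, hgF, hgc⟩ := hg x
    rcases le_total (1 / 2) r with hr | hr
    · have hcr : c r = 0 := max_eq_right (by linarith)
      have har : a r = 2 * r - 1 := max_eq_left (by linarith)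
      have hbr : b r = 2 - 2 * r := by simp only [b, hcr, har]; ring
      obtain ⟨s, hs, hfs⟩ := (f x).2.2
      rw [hcr, har, hbr, zero_smul, add_zero]
      refine ⟨hsimp hFx hgx (by linarith) (by linarith) (by ring), s, hs, fun v hv => hfs v ?_⟩
      intro h0
      have hF0 : F x v = 0 := h0
      have hg0 : g x v = 0 := by_contra fun h => hgF v h hF0
      exact hv (by simp [hF0, hg0])
    · have har : a r = 0 := max_eq_right (by linarith)
      have hcr : c r = 1 - 2 * r := max_eq_left (by linarith)
      have hbr : b r = 2 * r := by simp only [b, hcr, har]; ring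
      rw [hcr, har, hbr, zero_smul, zero_add]
      refine ⟨hsimp hgx (single_mem_stdSimplex ℝ v₀) (by linarith) (by linarith) (by ring),
        insert v₀ (Finset.univ.filter fun v => g x v ≠ 0),
        hK _ (Finset.insert_nonempty _ _) ((Finset.card_insert_le _ _).trans (by omega)),
        fun v hv => ?_⟩
      by_contra hnot
      simp only [Finset.mem_insert, Finset.mem_filter, Finset.mem_univ, true_and, not_or,
        not_not] at hnot
      exact hv (by simp [hnot.2, hnot.1])
  refine ⟨⟨fun y => ⟨H y, hmem y y.2⟩, by fun_prop⟩, fun x => Subtype.ext ?_⟩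
  have h1 := hHx 1 x zero_le_one
  rw [one_smul] at h1
  have ha1 : a 1 = 1 := by norm_num [a]
  have hc1 : c 1 = 0 := by norm_num [c]
  have hb1 : b 1 = 0 := by simp [b, ha1, hc1]
  rw [ha1, hb1, hc1, one_smul, zero_smul, zero_smul, add_zero, add_zero] at h1
  exact h1

theorem isKConnected_of_skeleton {V : Type*} [Fintype V] {K : PreAbstractSimplicialComplex V}
    {i : ℕ} (hV : i ≤ Fintype.card V)
    (hK : ∀ s : Finset V, s.Nonempty → s.card ≤ i → s ∈ K.faces) :
    IsKConnected ((i : ℤ) - 2) (geometricRealization K) := by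
  refine ⟨fun hi => ?_, fun m hm f => ?_⟩
  · obtain ⟨v⟩ : Nonempty V := Fintype.card_pos_iff.1 (by omega)
    exact nonempty_geometricRealization (hK {v} (Finset.singleton_nonempty v) (by simp; omega))
  · exact exists_extension_of_skeleton (by omega) (fun s hs hc => hK s hs (by omega)) f

/-- If every `i`-set of vertices has a common neighbor, the neighborhood complex contains the full
`(i-1)`-skeleton of the simplex on `V`. The hypothesis `i ≤ Fintype.card V` allows smaller sets to be
enlarged to `i`-sets. -/
theorem isKConnected_neighborhoodComplex {V : Type*} [Fintype V] (G : SimpleGraph V) {i : ℕ}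
    (hV : i ≤ Fintype.card V)
    (hG : ∀ s : Finset V, s.card = i → ∃ v, ∀ u ∈ s, G.Adj v u) :
    IsKConnected ((i : ℤ) - 2) (geometricRealization (neighborhoodComplex G)) := by
  refine isKConnected_of_skeleton hV fun s hs hsi => ⟨hs, ?_⟩
  obtain ⟨t, hst, ht⟩ := Finset.exists_superset_card_eq hsi hV
  obtain ⟨v, hv⟩ := hG t ht
  exact ⟨v, fun u hu => hv u (hst hu)⟩

/-! ### Common neighbors in the random graph -/

/-- For independent events grouped into disjoint blocks, the probability that every block contains
a failing event. -/
theorem measure_biInter_compl_biInter {Ω ι κ : Type*} [MeasurableSpace Ω] {P : Measure Ω}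
    [IsProbabilityMeasure P] {B : ι → Set Ω} (hBm : ∀ e, MeasurableSet (B e))
    (hB : iIndepSet B P) {E : κ → Finset ι} (T : Finset κ)
    (hE : (T : Set κ).PairwiseDisjoint E) :
    P (⋂ v ∈ T, (⋂ e ∈ E v, B e)ᶜ) = ∏ v ∈ T, (1 - ∏ e ∈ E v, P (B e)) := by
  classical
  induction T using Finset.induction_on with
  | empty => simp
  | insert v T hv ih =>
    have hdisj : Disjoint (E v : Set ι) (⋃ w ∈ T, (E w : Set ι)) := by
      rw [Set.disjoint_iUnion₂_right]
      intro w hw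
      exact Finset.disjoint_coe.2 (hE (by simp) (by simp [hw]) (by rintro rfl; exact hv hw))
    have hind := hB.indep_generateFrom_of_disjoint hBm _ _ hdisj
    have hmeas : ∀ (U : Set ι) (w : κ), (E w : Set ι) ⊆ U →
        MeasurableSet[MeasurableSpace.generateFrom {t | ∃ n ∈ U, B n = t}]
          (⋂ e ∈ E w, B e)ᶜ := fun U w hU => by
      refine MeasurableSet.compl (Finset.measurableSet_biInter _ fun e he => ?_)
      exact MeasurableSpace.measurableSet_generateFrom ⟨e, hU he, rfl⟩
    rw [Finset.set_biInter_insert, Finset.prod_insert hv,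
      (Indep_iff _ _ _).1 hind _ _ (hmeas _ v subset_rfl)
        (Finset.measurableSet_biInter _ fun w hw => hmeas _ w fun e he =>
          Set.mem_iUnion₂.2 ⟨w, hw, he⟩),
      ih (hE.subset (by simp)),
      prob_compl_eq_one_sub (Finset.measurableSet_biInter _ fun e _ => hBm e),
      hB.meas_biInter]

theorem SimpleGraph.measurableSet_of_finite {V : Type*} [Finite V] (S : Set (SimpleGraph V)) :
    MeasurableSet S := by
  have : S = SimpleGraph.edgeSet ⁻¹' (SimpleGraph.edgeSet '' S) :=
    (Set.preimage_image_eq S SimpleGraph.edgeSet_injective).symm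
  rw [this]
  exact SimpleGraph.measurable_edgeSet (Set.toFinite _).measurableSet

theorem binomialRandom_biInter_mem_edgeSet {V : Type*} [Finite V] [DecidableEq V]
    (p : unitInterval) (s : Finset (Sym2 V)) :
    SimpleGraph.binomialRandom V p (⋂ e ∈ s, {G | e ∈ G.edgeSet}) =
      ∏ e ∈ s, if e.IsDiag then 0 else (unitInterval.toNNReal p : ENNReal) := by
  rw [SimpleGraph.binomialRandom_eq_map, Measure.map_apply SimpleGraph.measurable_fromEdgeSet
    (SimpleGraph.measurableSet_of_finite _), setBernoulli_apply']
  have : (fun q : Sym2 V → Prop => {e | q e}) ⁻¹' (SimpleGraph.fromEdgeSet ⁻¹'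
      ⋂ e ∈ s, {G | e ∈ G.edgeSet}) = Set.pi s fun e => {x | x ∧ ¬ e.IsDiag} := by
    ext q
    simp [Set.mem_pi]
  rw [this, Measure.infinitePi_pi _ fun _ _ => (Set.toFinite _).measurableSet]
  refine Finset.prod_congr rfl fun e _ => ?_
  by_cases he : e.IsDiag
  · have hset : {x : Prop | x ∧ ¬ e.IsDiag} = ∅ := Set.eq_empty_of_forall_notMem fun _ hx => hx.2 he
    rw [hset, measure_empty, if_pos he]
  · have hset : {x : Prop | x ∧ ¬ e.IsDiag} = {True} := by
      ext x
      simp only [he, not_false_eq_true, and_true, Set.mem_ofPred_eq, Set.mem_singleton_iff,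
        eq_iff_iff, iff_true]
    have hmem : (e ∈ Sym2.diagSetᶜ) ∈ ({True} : Set Prop) :=
      eq_true (show e ∈ Sym2.diagSetᶜ by simpa using he)
    rw [hset, if_neg he, Measure.add_apply, Measure.smul_apply, Measure.smul_apply,
      Measure.dirac_apply_of_mem hmem,
      Measure.dirac_apply' _ (measurableSet_singleton _),
      Set.indicator_of_notMem (Set.mem_singleton_iff.not.2 fun h : False = True => of_eq_true h),
      smul_zero, add_zero,
      ENNReal.smul_def, smul_eq_mul, mul_one]

theorem iIndepSet_mem_edgeSet {V : Type*} [Finite V] (p : unitInterval) :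
    iIndepSet (fun e : Sym2 V => {G : SimpleGraph V | e ∈ G.edgeSet})
      (SimpleGraph.binomialRandom V p) := by
  classical
  rw [iIndepSet_iff_meas_biInter fun e => SimpleGraph.measurableSet_of_finite _]
  intro s
  rw [binomialRandom_biInter_mem_edgeSet]
  refine Finset.prod_congr rfl fun e _ => ?_
  have := binomialRandom_biInter_mem_edgeSet p {e}
  simp only [Finset.mem_singleton, Set.iInter_iInter_eq_left, Finset.prod_singleton] at this
  exact this.symm

/-- The vertices outside `s` are adjacent to all of `s` with probability `p ^ #s` each, independently,
as the sets of pairs `E v` joining them to `s` are disjoint. -/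
theorem binomialRandom_no_common_neighbor_le {V : Type*} [Fintype V] (p : unitInterval)
    (s : Finset V) :
    SimpleGraph.binomialRandom V p {G | ¬ ∃ v, ∀ u ∈ s, G.Adj v u} ≤
      (1 - (unitInterval.toNNReal p : ENNReal) ^ s.card) ^ (Fintype.card V - s.card) := by
  classical
  let E : V → Finset (Sym2 V) := fun v => s.image fun u => s(v, u)
  have hE : ((sᶜ : Finset V) : Set V).PairwiseDisjoint E := by
    intro v hv w hw hvw
    rw [Function.onFun, Finset.disjoint_left]
    intro e he he'
    obtain ⟨u, hu, rfl⟩ := Finset.mem_image.1 he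
    obtain ⟨u', hu', h⟩ := Finset.mem_image.1 he'
    rcases Sym2.eq_iff.1 h with ⟨h1, -⟩ | ⟨h1, -⟩
    · exact hvw h1.symm
    · exact Finset.mem_compl.1 hw (h1 ▸ hu)
  have hprod : ∀ v ∈ sᶜ, ∏ e ∈ E v, SimpleGraph.binomialRandom V p {G | e ∈ G.edgeSet} =
      (unitInterval.toNNReal p : ENNReal) ^ s.card := by
    intro v hv
    rw [← (iIndepSet_mem_edgeSet p).meas_biInter, binomialRandom_biInter_mem_edgeSet,
      Finset.prod_image fun u _ u' _ h => Sym2.congr_right.1 h, ← Finset.prod_const]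
    refine Finset.prod_congr rfl fun u hu => if_neg ?_
    rw [Sym2.mk_isDiag_iff]
    rintro rfl
    exact Finset.mem_compl.1 hv hu
  calc _ ≤ SimpleGraph.binomialRandom V p
        (⋂ v ∈ sᶜ, (⋂ e ∈ E v, {G | e ∈ G.edgeSet})ᶜ) := by
        refine measure_mono fun G hG => Set.mem_iInter₂.2 fun v _ hv => hG ⟨v, fun u hu => ?_⟩
        exact Set.mem_iInter₂.1 hv s(v, u) (Finset.mem_image_of_mem _ hu)
    _ = _ := by
        rw [measure_biInter_compl_biInter (fun _ => SimpleGraph.measurableSet_of_finite _)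
          (iIndepSet_mem_edgeSet p) _ hE, Finset.prod_congr rfl fun v hv => by rw [hprod v hv],
          Finset.prod_const, Finset.card_compl]

/-- The union bound over all `i`-sets of vertices. -/
theorem binomialRandom_exists_no_common_neighbor_le {V : Type*} [Fintype V] (p : unitInterval)
    (i : ℕ) :
    SimpleGraph.binomialRandom V p
        {G | ∃ s : Finset V, s.card = i ∧ ¬ ∃ v, ∀ u ∈ s, G.Adj v u} ≤
      ENNReal.ofReal ((Fintype.card V).choose i *
        (1 - (p : ℝ) ^ i) ^ (Fintype.card V - i)) := by
  have hunion : {G : SimpleGraph V | ∃ s : Finset V, s.card = i ∧ ¬ ∃ v, ∀ u ∈ s, G.Adj v u} =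
      ⋃ s ∈ Finset.powersetCard i Finset.univ, {G | ¬ ∃ v, ∀ u ∈ s, G.Adj v u} := by
    ext G
    simp [Finset.mem_powersetCard]
  have hp : (unitInterval.toNNReal p : ENNReal) = ENNReal.ofReal p := by
    rw [← unitInterval.coe_toNNReal, ENNReal.ofReal_coe_nnreal]
  calc _ ≤ ∑ s ∈ Finset.powersetCard i (Finset.univ : Finset V),
        SimpleGraph.binomialRandom V p {G | ¬ ∃ v, ∀ u ∈ s, G.Adj v u} := by
        rw [hunion]
        exact measure_biUnion_finset_le _ _
    _ ≤ ∑ s ∈ Finset.powersetCard i (Finset.univ : Finset V),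
        (1 - (unitInterval.toNNReal p : ENNReal) ^ i) ^ (Fintype.card V - i) :=
        Finset.sum_le_sum fun s hs => by
          simpa only [(Finset.mem_powersetCard.1 hs).2] using
            binomialRandom_no_common_neighbor_le p s
    _ = _ := by
        have h1 : (0 : ℝ) ≤ 1 - (p : ℝ) ^ i := sub_nonneg.2 (pow_le_one₀ p.2.1 p.2.2)
        rw [Finset.sum_const, Finset.card_powersetCard, Finset.card_univ, nsmul_eq_mul, hp,
          ENNReal.ofReal_mul (Nat.cast_nonneg _), ENNReal.ofReal_natCast, ENNReal.ofReal_pow h1,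
          ENNReal.ofReal_sub _ (pow_nonneg p.2.1 i), ENNReal.ofReal_one,
          ENNReal.ofReal_pow p.2.1]

theorem theorem1 (p : ℕ → unitInterval) (i : ℕ → ℕ) (hi : ∀ᶠ n in atTop, i n ≤ n)
    (h : (fun n : ℕ => (n.choose (i n) : ℝ) * (1 - (p n : ℝ) ^ i n) ^ (n - i n))
      =o[atTop] (fun _ : ℕ => (1 : ℝ))) :
    AlmostAlways p (fun n G =>
      IsKConnected ((i n : ℤ) - 2) (geometricRealization (neighborhoodComplex G))) := by
  have hlim := ENNReal.tendsto_ofReal (isLittleO_one_iff ℝ |>.1 h)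
  rw [ENNReal.ofReal_zero] at hlim
  have hlow := ENNReal.Tendsto.sub (tendsto_const_nhds (x := (1 : ENNReal))) hlim
    (Or.inl ENNReal.one_ne_top)
  rw [tsub_zero] at hlow
  refine tendsto_of_tendsto_of_tendsto_of_le_of_le' hlow tendsto_const_nhds ?_
    (Eventually.of_forall fun n => prob_le_one)
  filter_upwards [hi] with n hn
  have hbad := binomialRandom_exists_no_common_neighbor_le (V := Fin n) (p n) (i n)
  rw [Fintype.card_fin] at hbad
  refine (tsub_le_tsub_left hbad 1).trans ?_
  rw [← prob_compl_eq_one_sub (SimpleGraph.measurableSet_of_finite _)]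
  refine measure_mono fun G hG => ?_
  refine isKConnected_neighborhoodComplex G (by simpa using hn) fun s hs => ?_
  by_contra hno
  exact hG ⟨s, hs, hno⟩
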